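/- Consider the firefighter game on the infinite hexagonal grid $G_{hex}$ (the honeycomb graph, every vertex of degree 3) with one firefighter. A position of the game consists of a set of burning vertices and a disjoint set of protected vertices. In each turn $1,2,3,\dots$ the firefighter first protects one vertex that is not burning, and then the fire spreads to all unprotected neighbors of the burning vertices; burning and protected vertices stay so forever. For vertices $u,v$ let $d(u,v)$ be the graph distance in $G_{hex}$. There is a universal constant $c<1$ with the following property, and moreover every real $c>\frac{1}{1+2^{-8}}$ has it: for every position with only finitely many burning vertices there exist a vertex $v_0$ and a strategy of the firefighter such that for every large enough $T$ all vertices burning after turn $T$ (turns being counted from the given position) are at distance at most $c\cdot T$ from $v_0$. -/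

import Mathlib

/-- A vertex of the hexagonal grid: an integer point `(x, y, z)` with `x + y + z = 0` or
`x + y + z = 1`.  Projecting these points orthogonally onto the plane `x + y + z = 0` yields the
vertices of a regular honeycomb; the two values of the sum are the two sides of its bipartition. -/
@[ext]
structure HexVertex where
  x : ℤ
  y : ℤ
  z : ℤ
  sum_eq : x + y + z = 0 ∨ x + y + z = 1

/-- The infinite hexagonal grid: two vertices are adjacent when they differ by one unit in exactly
one coordinate.  So `(x, y, z)` with sum `0` has the three neighbours
`(x + 1, y, z)`, `(x, y + 1, z)`, `(x, y, z + 1)`, and `(x, y, z)` with sum `1` has the three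
neighbours `(x - 1, y, z)`, `(x, y - 1, z)`, `(x, y, z - 1)`. -/
def hexGrid : SimpleGraph HexVertex where
  Adj u v := |u.x - v.x| + |u.y - v.y| + |u.z - v.z| = 1
  symm := ⟨fun u v h => by
    rw [abs_sub_comm v.x, abs_sub_comm v.y, abs_sub_comm v.z]; exact h⟩
  loopless := ⟨fun u h => by simp at h⟩

/-- A position of the firefighter game: the set of burning vertices and the set of protected
vertices. -/
structure FirePosition (V : Type*) where
  burning : Set V
  guarded : Set V

/-- One turn: the firefighter protects `p`, and then the fire spreads to all unprotected
neighbours of the burning vertices. -/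
def FirePosition.turn {V : Type*} (G : SimpleGraph V) (s : FirePosition V) (p : V) :
    FirePosition V where
  guarded := insert p s.guarded
  burning := s.burning ∪ {w | w ∉ insert p s.guarded ∧ ∃ u ∈ s.burning, G.Adj u w}

/-- The position after turn `T` of the game that starts at the position `s` (after turn `0`) and
in which the firefighter protects `p T` in turn `T + 1`. -/
def firePlay {V : Type*} (G : SimpleGraph V) (s : FirePosition V) (p : ℕ → V) :
    ℕ → FirePosition V
  | 0 => s
  | T + 1 => (firePlay G s p T).turn G (p T)

/-- The strategy `p` of a single firefighter is playable from `s`: a vertex that gets protected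
in some turn is not on fire before that turn.  (The spread of the fire is deterministic, so a
strategy from a given position is the sequence of vertices to be protected.) -/
def IsPlayable {V : Type*} (G : SimpleGraph V) (s : FirePosition V) (p : ℕ → V) : Prop :=
  ∀ T : ℕ, p T ∉ (firePlay G s p T).burning

/-- One firefighter can slow the fire on the hexagonal grid down by the factor `c`: from every
position with finitely many burning vertices there are a center `v₀` and a strategy such that for
every large enough `T` all vertices burning after turn `T` are at distance at most `c * T` from
`v₀`. -/
def CanSlowHexFire (c : ℝ) : Prop :=
  ∀ s : FirePosition HexVertex, s.burning.Finite → Disjoint s.burning s.guarded →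
    ∃ (v₀ : HexVertex) (p : ℕ → HexVertex), IsPlayable hexGrid s p ∧
      ∃ T₀ : ℕ, ∀ T ≥ T₀, ∀ w ∈ (firePlay hexGrid s p T).burning,
        (hexGrid.dist w v₀ : ℝ) ≤ c * T

/-! Each `height k` changes by at most one along an edge, and the six of them bound the distance to
the origin. The firefighter builds a spiral of sides at height `2 ^ k * H` in direction `k`. Half
the `position` of a barrier vertex is the mean of two of its heights, hence at most its norm, so one
vertex per turn keeps ahead even of an unimpeded fire (`exists_strategy_eq`).

The fire is thus confined to the spiral channel and can change sectors only through gates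
(`gate_of_adj`). At the gate from sector `k` to `k + 1` the height in the new direction `k + 2` lags
at least `level H k` behind that in direction `k + 1`; this adds to the delay (`Reached.adj`). In
sector `k` the norm is at most `64 * level H k`, hence at most `256 * (delay + H)`. With norm plus
delay at most `T + R`, where `R` bounds the initial norms, this gives the slope `256 / 257`. -/

/-! ### Heights and distance -/

namespace HexVertex

/-- The six unit-speed coordinates of the hexagonal grid, in cyclic order: the ball of radius `n`
around the origin is the set where all of them are at most `n`. -/
def height : ℕ → HexVertex → ℤ
  | 0, v => v.x - v.y - v.z
  | 1, v => v.x + v.y - v.z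
  | 2, v => v.y - v.x - v.z
  | k + 3, v => -height k v

theorem height_add_three (k : ℕ) (v : HexVertex) : height (k + 3) v = -height k v := rfl

theorem height_add_six (k : ℕ) (v : HexVertex) : height (k + 6) v = height k v := by
  rw [show k + 6 = k + 3 + 3 from rfl, height_add_three, height_add_three, neg_neg]

theorem abs_height_sub {u v : HexVertex} (h : hexGrid.Adj u v) :
    ∀ k, |height k u - height k v| ≤ 1
  | 0 | 1 | 2 => by
    have h' : |u.x - v.x| + |u.y - v.y| + |u.z - v.z| = 1 := h
    simp only [height]
    grind
  | k + 3 => by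
    have := abs_height_sub h k
    rw [height_add_three, height_add_three]
    grind

/-- A direction is the sum of its two neighbours in cyclic order; the error is the coordinate sum up
to sign. -/
theorem abs_height_add_sub (v : HexVertex) :
    ∀ k, |height k v + height (k + 2) v - height (k + 1) v| ≤ 1
  | 0 | 1 | 2 => by
    have := v.sum_eq
    simp only [height]
    grind
  | k + 3 => by
    have := abs_height_add_sub v k
    rw [show k + 3 + 2 = k + 2 + 3 from rfl, show k + 3 + 1 = k + 1 + 3 from rfl,
      height_add_three, height_add_three, height_add_three]
    grind

theorem height_parity (v : HexVertex) (k : ℕ) : ∃ a, height k v + height (k + 1) v = 2 * a := by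
  induction k using Nat.strong_induction_on with
  | _ k ih =>
    match k with
    | 0 => exact ⟨v.x - v.z, by simp only [height]; ring⟩
    | 1 => exact ⟨v.y - v.z, by simp only [height]; ring⟩
    | 2 => exact ⟨v.y - v.x, by simp only [height]; ring⟩
    | k + 3 =>
      obtain ⟨a, ha⟩ := ih k (by lia)
      refine ⟨-a, ?_⟩
      rw [show k + 3 + 1 = k + 1 + 3 from rfl, height_add_three, height_add_three]
      lia

theorem ext_height {v w : HexVertex} :
    ∀ k, height k v = height k w → height (k + 1) v = height (k + 1) w → v = w
  | 0 | 1 | 2 => by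
    have hv := v.sum_eq
    have hw := w.sum_eq
    simp only [height]
    intro h₁ h₂
    ext <;> lia
  | k + 3 => by
    intro h₁ h₂
    rw [show k + 3 + 1 = k + 1 + 3 from rfl] at h₂
    simp only [height_add_three, neg_inj] at h₁ h₂
    exact ext_height k h₁ h₂

theorem height_le_of_six {v : HexVertex} {M : ℤ} {k : ℕ} (h : ∀ j < 6, height (k + j) v ≤ M) :
    ∀ j < 6, height j v ≤ M := by
  induction k with
  | zero => simpa using h
  | succ k ih =>
    refine ih fun j hj => ?_
    rcases j with _ | j
    · have := h 5 (by lia)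
      rwa [show k + 1 + 5 = k + 6 from rfl, height_add_six] at this
    · have := h j (by lia)
      rwa [show k + 1 + j = k + (j + 1) by lia] at this

/-- The sum of the absolute values of the coordinates, which bounds the distance to the origin. -/
def norm (v : HexVertex) : ℤ := |v.x| + |v.y| + |v.z|

theorem norm_le {v : HexVertex} {M : ℤ} (h : ∀ j < 6, height j v ≤ M) : v.norm ≤ M := by
  have h0 := h 0 (by lia)
  have h1 := h 1 (by lia)
  have h2 := h 2 (by lia)
  have h3 := h 3 (by lia)
  have h4 := h 4 (by lia)
  have h5 := h 5 (by lia)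
  simp only [height] at h0 h1 h2 h3 h4 h5
  have := v.sum_eq
  unfold norm
  grind

theorem height_le_norm (v : HexVertex) : ∀ k, height k v ≤ v.norm := by
  intro k
  suffices |height k v| ≤ v.norm from (le_abs_self _).trans this
  induction k using Nat.strong_induction_on with
  | _ k ih =>
    match k with
    | 0 | 1 | 2 => simp only [height, norm]; grind
    | k + 3 => rw [height_add_three, abs_neg]; exact ih k (by lia)

/-- The origin of the grid. -/
def origin : HexVertex := ⟨0, 0, 0, Or.inl rfl⟩

theorem exists_adj_norm_lt {v : HexVertex} (hv : v ≠ origin) :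
    ∃ u, hexGrid.Adj v u ∧ u.norm + 1 = v.norm := by
  obtain ⟨x, y, z, hs⟩ := v
  have hne : ¬(x = 0 ∧ y = 0 ∧ z = 0) := by
    rintro ⟨rfl, rfl, rfl⟩
    exact hv rfl
  rcases hs with hs | hs
  · have : x < 0 ∨ y < 0 ∨ z < 0 := by lia
    rcases this with h | h | h
    · exact ⟨⟨x + 1, y, z, by lia⟩, by simp [hexGrid], by simp only [norm]; grind⟩
    · exact ⟨⟨x, y + 1, z, by lia⟩, by simp [hexGrid], by simp only [norm]; grind⟩
    · exact ⟨⟨x, y, z + 1, by lia⟩, by simp [hexGrid], by simp only [norm]; grind⟩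
  · have : 0 < x ∨ 0 < y ∨ 0 < z := by lia
    rcases this with h | h | h
    · exact ⟨⟨x - 1, y, z, by lia⟩, by simp [hexGrid], by simp only [norm]; grind⟩
    · exact ⟨⟨x, y - 1, z, by lia⟩, by simp [hexGrid], by simp only [norm]; grind⟩
    · exact ⟨⟨x, y, z - 1, by lia⟩, by simp [hexGrid], by simp only [norm]; grind⟩

theorem exists_walk_length_eq_norm (n : ℕ) :
    ∀ v : HexVertex, v.norm = n → ∃ q : hexGrid.Walk v origin, q.length = n := by
  induction n with
  | zero =>
    intro v hv
    have hzero : v = origin := by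
      unfold norm at hv
      ext <;> simp only [origin] <;> grind
    subst hzero
    exact ⟨.nil, rfl⟩
  | succ n ih =>
    intro v hv
    have hne : v ≠ origin := by
      rintro rfl
      simp only [norm, origin, abs_zero] at hv
      lia
    obtain ⟨u, hadj, hu⟩ := exists_adj_norm_lt hne
    obtain ⟨q, hq⟩ := ih u (by push_cast at hv; lia)
    exact ⟨.cons hadj q, by simp [hq]⟩

theorem dist_origin_le_norm (v : HexVertex) : (hexGrid.dist v origin : ℤ) ≤ v.norm := by
  have hn : 0 ≤ v.norm := by unfold norm; positivity
  obtain ⟨n, hn⟩ := Int.eq_ofNat_of_zero_le hn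
  obtain ⟨q, hq⟩ := exists_walk_length_eq_norm n v hn
  have := SimpleGraph.dist_le q
  lia

end HexVertex

open HexVertex

/-! ### The spiral barrier -/

namespace HexSpiral

/-- The height of the `k`-th side of the spiral barrier. -/
def level (H : ℤ) (k : ℕ) : ℤ := 2 ^ k * H

theorem level_zero (H : ℤ) : level H 0 = H := by simp [level]

theorem level_succ (H : ℤ) (k : ℕ) : level H (k + 1) = 2 * level H k := by
  simp only [level, pow_succ]
  ring

theorem level_mono {H : ℤ} (hH : 0 ≤ H) : Monotone (level H) := fun _ _ h =>
  mul_le_mul_of_nonneg_right (pow_le_pow_right₀ (by norm_num) h) hH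

theorem le_level {H : ℤ} (hH : 0 ≤ H) (k : ℕ) : H ≤ level H k := by
  simpa [level_zero] using level_mono hH (Nat.zero_le k)

/-- The side of the spiral barrier at height `level H (m + 1)` in direction `m + 1`; consecutive
sides share a corner. -/
def side (H : ℤ) (m : ℕ) : Set HexVertex :=
  {v | height (m + 1) v = level H (m + 1) ∧ height m v ≤ level H m ∧
    height (m + 2) v ≤ level H (m + 2)}

/-- Twice the position along the spiral barrier of a vertex of `side H m`. -/
def position (H : ℤ) (m : ℕ) (v : HexVertex) : ℤ := level H (m + 1) + height (m + 2) v

/-- All heights of a vertex have the same parity. On a side they are even, so the error of at most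
one vanishes. -/
theorem height_of_mem_side {H : ℤ} (hH : Even H) {m : ℕ} {v : HexVertex} (hv : v ∈ side H m) :
    height m v + height (m + 2) v = height (m + 1) v := by
  obtain ⟨b, hb⟩ := hH
  obtain ⟨h₁, -, -⟩ := hv
  obtain ⟨a, ha⟩ := height_parity v m
  obtain ⟨c, hc⟩ := height_parity v (m + 1)
  have := abs_le.1 (abs_height_add_sub v m)
  have hl := level_succ H m
  rw [show m + 1 + 1 = m + 2 from rfl] at hc
  lia

theorem position_bounds {H : ℤ} (hH : Even H) {m : ℕ} {v : HexVertex} (hv : v ∈ side H m) :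
    3 * level H m ≤ position H m v ∧ position H m v ≤ 3 * level H (m + 1) := by
  have := height_of_mem_side hH hv
  obtain ⟨h₁, h₂, h₃⟩ := hv
  have h₄ := level_succ H m
  have h₅ : level H (m + 2) = 2 * level H (m + 1) := level_succ H (m + 1)
  unfold position
  constructor <;> lia

/-- The position ranges of different sides meet only for consecutive sides, and then only in the
value at the common corner. -/
theorem position_injective {H : ℤ} (hH : Even H) (hpos : 0 < H) {m n : ℕ} {v w : HexVertex}
    (hv : v ∈ side H m) (hw : w ∈ side H n) (h : position H m v = position H n w) : v = w := by
  wlog hmn : m ≤ n generalizing m n v w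
  · exact (this hw hv h.symm (by lia)).symm
  rcases hmn.eq_or_lt with rfl | hlt
  · exact ext_height (m + 1) (hv.1.trans hw.1.symm) (by unfold position at h; lia)
  · have hv' := (position_bounds hH hv).2
    have hw' := (position_bounds hH hw).1
    have hl := level_mono hpos.le (show m + 1 ≤ n from hlt)
    have hlm := le_level hpos.le (m + 1)
    obtain rfl : n = m + 1 := by
      by_contra hne
      have h₁ := level_mono hpos.le (show m + 2 ≤ n by lia)
      have h₂ : level H (m + 2) = 2 * level H (m + 1) := level_succ H (m + 1)
      lia
    have hb := height_of_mem_side hH hw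
    have h₁ : level H (m + 1) = 2 * level H m := level_succ H m
    have h₂ : level H (m + 2) = 2 * level H (m + 1) := level_succ H (m + 1)
    have hv₁ := hv.1
    have hw₁ := hw.1
    unfold position at *
    simp only [show m + 1 + 1 = m + 2 from rfl, show m + 1 + 2 = m + 3 from rfl] at *
    exact ext_height (m + 1) (by lia) (by rw [show m + 1 + 1 = m + 2 from rfl]; lia)

/-! ### Sectors, gates and delay -/

/-- A lower bound for the delay that the barrier causes: in the `k`-th sector the fire reaches the
height `a` in the directions `k - 1`, `k`, `k + 1` at time `a + delay H k`, `a + delay H (k + 1)`,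
`a + delay H (k + 2)` at the earliest. -/
def delay (H : ℤ) : ℕ → ℤ
  | 0 | 1 | 2 => 0
  | k + 3 => delay H (k + 2) + level H k

theorem delay_le_succ {H : ℤ} (hH : 0 ≤ H) : ∀ k, delay H k ≤ delay H (k + 1)
  | 0 | 1 => le_rfl
  | k + 2 => by
    have := le_level hH k
    simp only [delay]
    lia

/-- The delay is a geometric sum, equal to `level H (k - 2) - H` for `k ≥ 2`, where equality holds.
-/
theorem level_le_delay {H : ℤ} (hH : 0 ≤ H) : ∀ k, level H k ≤ 4 * delay H k + 4 * H
  | 0 => by simp only [delay, level_zero]; lia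
  | 1 => by simp only [delay, level_succ, level_zero]; lia
  | 2 => by simp only [delay, level_succ, level_zero]; lia
  | k + 3 => by
    have := level_le_delay hH (k + 2)
    simp only [delay, level_succ] at *
    lia

/-- The vertices in the `k`-th sector of the channel between the windings of the barrier. -/
def sector (H : ℤ) (k : ℕ) : Set HexVertex :=
  {v | (k = 0 ∨ level H k < height k v) ∧ ∀ j > k, height j v ≤ level H j}

theorem exists_mem_sector {H : ℤ} (hH : 0 < H) (v : HexVertex) : ∃ k, v ∈ sector H k := by
  classical
  have hbound : ∀ j > v.norm.toNat, height j v ≤ level H j := by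
    intro j hj
    have h₁ := height_le_norm v j
    have h₂ : (j : ℤ) < 2 ^ j := by exact_mod_cast Nat.lt_two_pow_self
    have h₃ : (2 : ℤ) ^ j * 1 ≤ level H j := mul_le_mul_of_nonneg_left hH (by positivity)
    lia
  refine ⟨Nat.findGreatest (fun k => level H k < height k v) v.norm.toNat, ?_, fun j hj => ?_⟩
  · by_cases h0 : Nat.findGreatest (fun k => level H k < height k v) v.norm.toNat = 0
    · exact Or.inl h0
    · exact Or.inr (Nat.findGreatest_of_ne_zero rfl h0)
  · by_cases hjn : j ≤ v.norm.toNat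
    · exact not_lt.1 (Nat.findGreatest_is_greatest hj hjn)
    · exact hbound j (by lia)

/-- Away from the barrier, adjacent vertices lie in the same sector or in consecutive ones, and in
the latter case the edge crosses the gate between the two sectors. -/
theorem gate_of_adj {H : ℤ} {u w : HexVertex} (h : hexGrid.Adj u w)
    (hu : ∀ m, u ∉ side H m) {k l : ℕ} (huk : u ∈ sector H k) (hwl : w ∈ sector H l)
    (hkl : k < l) :
    l = k + 1 ∧ height l u = level H l ∧ level H k < height k u := by
  have hul := huk.2 l hkl
  have hwl' : level H l < height l w := hwl.1.resolve_left (by lia)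
  have hd := abs_le.1 (abs_height_sub h l)
  have heq : height l u = level H l := by lia
  obtain ⟨m, rfl⟩ : ∃ m, l = m + 1 := ⟨l - 1, by lia⟩
  -- On the line of side `m` but not on that side, `u` must lie beyond its end.
  have hm : level H m < height m u := by
    by_contra hm
    exact hu m ⟨heq, not_lt.1 hm, huk.2 (m + 2) (by lia)⟩
  obtain rfl : m = k := by
    by_contra hne
    exact absurd (huk.2 m (by lia)) (not_le.2 hm)
  exact ⟨rfl, heq, hm⟩

/-- A necessary condition for a vertex of the `k`-th sector to be reached by time `T` by a fire that
starts near the origin and is slowed down by the barrier. -/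
def Reached (H : ℤ) (k : ℕ) (T : ℤ) (v : HexVertex) : Prop :=
  height (k + 5) v + delay H k ≤ T ∧ height k v + delay H (k + 1) ≤ T ∧
    height (k + 1) v + delay H (k + 2) ≤ T

theorem Reached.adj {H : ℤ} (hH : 0 < H) {u w : HexVertex} (h : hexGrid.Adj u w)
    (hu : ∀ m, u ∉ side H m) (hw : ∀ m, w ∉ side H m) {k l : ℕ} {T : ℤ}
    (huk : u ∈ sector H k) (hwl : w ∈ sector H l) (hT : Reached H k T u) :
    Reached H l (T + 1) w := by
  have hd j := abs_le.1 (abs_height_sub h j)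
  obtain ⟨h₁, h₂, h₃⟩ := hT
  rcases lt_trichotomy k l with hkl | rfl | hkl
  · obtain ⟨rfl, heq, hgt⟩ := gate_of_adj h hu huk hwl hkl
    have hr := abs_le.1 (abs_height_add_sub u k)
    have hd₁ := hd k
    have hd₂ := hd (k + 1)
    have hd₃ := hd (k + 2)
    refine ⟨?_, ?_, ?_⟩
    · rw [show k + 1 + 5 = k + 6 from rfl, height_add_six]
      lia
    · rw [show k + 1 + 1 = k + 2 from rfl]
      lia
    -- Only this direction is new. At the gate, height `k + 1` equals `2 * level H k` and height `k`
    -- exceeds `level H k`, so height `k + 2` is at most `level H k`.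
    · have hdel : delay H (k + 1 + 2) = delay H (k + 2) + level H k := rfl
      rw [hdel, show k + 1 + 1 = k + 2 from rfl]
      lia
  · have hd₁ := hd (k + 5)
    have hd₂ := hd k
    have hd₃ := hd (k + 1)
    exact ⟨by lia, by lia, by lia⟩
  · obtain ⟨rfl, heq, hgt⟩ := gate_of_adj h.symm hw hwl huk hkl
    rw [show l + 1 + 5 = l + 6 from rfl, height_add_six] at h₁
    rw [show l + 1 + 1 = l + 2 from rfl] at h₂
    have hd₁ := hd l
    have hd₂ := hd (l + 1)
    -- Going back, only direction `l + 5` is new; since height `l + 1` is positive at the gate,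
    -- height `l` bounds it.
    have hr := abs_le.1 (abs_height_add_sub w (l + 5))
    rw [show l + 5 + 1 = l + 6 from rfl, show l + 5 + 2 = l + 1 + 6 from rfl, height_add_six,
      height_add_six] at hr
    have hpos := le_level hH.le (l + 1)
    have hmono := delay_le_succ hH.le l
    exact ⟨by lia, by lia, by lia⟩

theorem Reached.norm_add_delay_le {H : ℤ} (hH : 0 < H) {k : ℕ} {T : ℤ} {v : HexVertex}
    (hv : v ∈ sector H k) (hT : Reached H k T v) (hle : v.norm ≤ T) :
    v.norm + delay H k ≤ T := by
  rcases k with _ | k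
  · simpa [delay] using hle
  obtain ⟨h₁, h₂, h₃⟩ := hT
  have hk : level H (k + 1) < height (k + 1) v := hv.1.resolve_left (by lia)
  have hpos := le_level hH.le (k + 1)
  have hm₁ := delay_le_succ hH.le (k + 1)
  have hm₂ := delay_le_succ hH.le (k + 2)
  have hr₁ := abs_le.1 (abs_height_add_sub v (k + 1))
  have hr₂ := abs_le.1 (abs_height_add_sub v (k + 5))
  simp only [add_assoc, Nat.reduceAdd] at *
  have h₆ := height_add_six k v
  have h₇ := height_add_six (k + 1) v
  have h₃' := height_add_three (k + 1) v
  simp only [add_assoc, Nat.reduceAdd] at *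
  -- `Reached` bounds three directions. As the height in the middle one is positive, the opposite
  -- height is negative, and each of the other two is at most its neighbour among the three.
  suffices v.norm ≤ T - delay H (k + 1) by lia
  refine norm_le (height_le_of_six (k := k + 1) fun j hj => ?_)
  simp only [add_assoc]
  interval_cases j <;> simp only [Nat.reduceAdd] <;> lia

theorem norm_le_level {H : ℤ} (hH : 0 ≤ H) {k : ℕ} {v : HexVertex} (hv : v ∈ sector H k) :
    v.norm ≤ level H (k + 6) := by
  refine norm_le (height_le_of_six (k := k + 1) fun j hj => ?_)
  exact (hv.2 (k + 1 + j) (by lia)).trans (level_mono hH (by lia))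

/-! ### The strategy and the invariant of the play -/

open Classical in
/-- The strategy that builds the barrier along the spiral, skipping its first `C` positions, which
are void. -/
noncomputable def strategy (H C : ℤ) (v₀ : HexVertex) (T : ℕ) : HexVertex :=
  if h : ∃ v, ∃ m, v ∈ side H m ∧ position H m v = 2 * (T + C) then h.choose else v₀

/-- The default vertex also lies on the barrier, so the strategy is playable as soon as the fire
avoids the barrier. -/
theorem strategy_mem {H C : ℤ} {v₀ : HexVertex} {n : ℕ} (h₀ : v₀ ∈ side H n) (T : ℕ) :
    ∃ m, strategy H C v₀ T ∈ side H m := by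
  unfold strategy
  split_ifs with h
  · exact h.choose_spec.imp fun _ => And.left
  · exact ⟨n, h₀⟩

theorem strategy_eq {H C : ℤ} (hH : Even H) (hpos : 0 < H) {v₀ v : HexVertex} {m T : ℕ}
    (hv : v ∈ side H m) (h : position H m v = 2 * (T + C)) : strategy H C v₀ T = v := by
  have hex : ∃ v, ∃ m, v ∈ side H m ∧ position H m v = 2 * (T + C) := ⟨v, m, hv, h⟩
  obtain ⟨n, hn, hpn⟩ := hex.choose_spec
  rw [strategy, dif_pos hex]
  exact position_injective hH hpos hn hv (hpn.trans h.symm)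

/-- The barrier is built fast enough even against a fire that spreads unimpededly. -/
theorem exists_strategy_eq {H C : ℤ} (hH : Even H) (hC : 0 ≤ C) (hCH : C < H) {v₀ v : HexVertex}
    {m : ℕ} (hv : v ∈ side H m) {T : ℕ} (hT : v.norm ≤ T + C) :
    ∃ t ≤ T, strategy H C v₀ t = v := by
  obtain ⟨a, ha⟩ := height_parity v (m + 1)
  rw [hv.1, show m + 1 + 1 = m + 2 from rfl] at ha
  have hb := (position_bounds hH hv).1
  have hl := le_level (hC.trans hCH.le) m
  have h₁ := height_le_norm v (m + 1)
  have h₂ := height_le_norm v (m + 2)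
  have h₃ := hv.1
  have hp : position H m v = 2 * a := ha
  -- Here `2 * a ≥ 3 * H > 2 * C`, so `toNat` truncates nothing, and `a` is at most the norm.
  refine ⟨(a - C).toNat, by lia, strategy_eq hH (by lia) hv ?_⟩
  lia

theorem side_zero_nonempty {H : ℤ} (hH : 0 ≤ H) : ∃ v, v ∈ side H 0 := by
  refine ⟨⟨0, H, -H, Or.inl (by ring)⟩, ?_, ?_, ?_⟩ <;>
    simp only [height, level_succ, level_zero, zero_add] <;> lia

end HexSpiral

theorem mem_guarded_firePlay {V : Type*} (G : SimpleGraph V) (s : FirePosition V) (p : ℕ → V)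
    {t T : ℕ} (h : t ≤ T) : p t ∈ (firePlay G s p (T + 1)).guarded := by
  induction T with
  | zero =>
    obtain rfl : t = 0 := by lia
    exact Set.mem_insert _ _
  | succ T ih =>
    rcases h.eq_or_lt with rfl | h
    · exact Set.mem_insert _ _
    · exact Set.mem_insert_of_mem _ (ih (by lia))

open HexSpiral

/-- The three claims need one another: the norm bound makes the guards timely, which keeps the fire
off the barrier, which lets `Reached` propagate. -/
theorem HexSpiral.firePlay_invariant {H R : ℤ} (hR : 0 ≤ R) (hH : Even H) (hRH : R + 1 < H)
    {s : FirePosition HexVertex} (hs : ∀ v ∈ s.burning, v.norm ≤ R) (v₀ : HexVertex) (T : ℕ) :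
    ∀ v ∈ (firePlay hexGrid s (strategy H (R + 1) v₀) T).burning,
      (∀ m, v ∉ side H m) ∧ v.norm ≤ T + R ∧ ∀ k, v ∈ sector H k → Reached H k (T + R) v := by
  have hpos : 0 < H := by lia
  induction T with
  | zero =>
    intro v hv
    have hn := hs v hv
    have hlow j : height j v ≤ R := (height_le_norm v j).trans hn
    refine ⟨fun m hm => ?_, by simpa using hn, fun k hk => ?_⟩
    · have := le_level hpos.le (m + 1)
      have := hm.1
      have := hlow (m + 1)
      lia
    · obtain rfl : k = 0 := by
        by_contra hne
        have := hk.1.resolve_left hne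
        have := le_level hpos.le k
        have := hlow k
        lia
      have h₁ := hlow 5
      have h₂ := hlow 0
      have h₃ := hlow 1
      simp only [Reached, delay, zero_add, add_zero, Nat.cast_zero]
      exact ⟨h₁, h₂, h₃⟩
  | succ T ih =>
    rintro w (hw | ⟨hguard, u, hu, hadj⟩)
    · obtain ⟨h₁, h₂, h₃⟩ := ih w hw
      refine ⟨h₁, by push_cast; lia, fun k hk => ?_⟩
      obtain ⟨a, b, c⟩ := h₃ k hk
      push_cast
      exact ⟨by lia, by lia, by lia⟩
    · obtain ⟨h₁, h₂, h₃⟩ := ih u hu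
      have hnorm : w.norm ≤ T + R + 1 := by
        refine norm_le fun j _ => ?_
        have := abs_le.1 (abs_height_sub hadj j)
        have := height_le_norm u j
        lia
      have hside : ∀ m, w ∉ side H m := by
        intro m hm
        -- The offset `R + 1` is exact: a vertex catching fire in turn `T + 1` has norm at most `T +
        -- (R + 1)`, and guarding precedes spreading.
        obtain ⟨t, ht, rfl⟩ := exists_strategy_eq (v₀ := v₀) (T := T) hH (by lia : 0 ≤ R + 1) hRH hm
          (by lia)
        exact hguard (mem_guarded_firePlay _ _ _ ht)
      refine ⟨hside, by push_cast; lia, fun k hk => ?_⟩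
      obtain ⟨l, hl⟩ := exists_mem_sector hpos u
      have := (h₃ l hl).adj hpos hadj h₁ hside hl hk
      push_cast
      rwa [show (T : ℤ) + 1 + R = T + R + 1 by ring]

theorem canSlowHexFire {c : ℝ} (hc : 256 / 257 < c) : CanSlowHexFire c := by
  intro s hfin _
  obtain ⟨R, hR, hs⟩ : ∃ R : ℤ, 0 ≤ R ∧ ∀ v ∈ s.burning, v.norm ≤ R := by
    obtain ⟨R, hR⟩ := (hfin.image HexVertex.norm).bddAbove
    exact ⟨max R 0, le_max_right _ _, fun v hv =>
      (hR (Set.mem_image_of_mem _ hv)).trans (le_max_left _ _)⟩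
  obtain ⟨H, hH, hRH⟩ : ∃ H : ℤ, Even H ∧ R + 1 < H := ⟨2 * (R + 1), even_two_mul _, by lia⟩
  have hpos : 0 < H := by lia
  obtain ⟨b, hb⟩ := side_zero_nonempty hpos.le
  have hinv := firePlay_invariant hR hH hRH hs b
  refine ⟨origin, strategy H (R + 1) b, fun T hT => ?_, ?_⟩
  · obtain ⟨m, hm⟩ := strategy_mem (C := R + 1) hb T
    exact (hinv T _ hT).1 m hm
  -- From `T₀` on, the surplus slope `c - 256 / 257` absorbs the constant term.
  obtain ⟨T₀, hT₀⟩ := exists_nat_ge ((256 / 257 * (R + H) : ℝ) / (c - 256 / 257))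
  refine ⟨T₀, fun T hT w hw => ?_⟩
  obtain ⟨-, hle, hreach⟩ := hinv T w hw
  obtain ⟨k, hk⟩ := exists_mem_sector hpos w
  have h₁ := (hreach k hk).norm_add_delay_le hpos hk hle
  have h₂ := norm_le_level hpos.le hk
  have h₃ := level_le_delay hpos.le k
  have h₄ : level H (k + 6) = 64 * level H k := by simp only [level_succ]; ring
  have h₅ := dist_origin_le_norm w
  have h₆ : 257 * (hexGrid.dist w origin : ℤ) ≤ 256 * (T + R + H) := by lia
  have h₇ : 257 * (hexGrid.dist w origin : ℝ) ≤ 256 * (T + R + H) := by exact_mod_cast h₆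
  have h₈ : (T₀ : ℝ) ≤ T := by exact_mod_cast hT
  have h₉ := (div_le_iff₀ (sub_pos.2 hc)).1 (hT₀.trans h₈)
  linarith

theorem theorem4 :
    (∃ c : ℝ, c < 1 ∧ CanSlowHexFire c) ∧
      ∀ c : ℝ, 1 / (1 + (2 : ℝ) ^ (-8 : ℤ)) < c → CanSlowHexFire c := by
  refine ⟨⟨999 / 1000, by norm_num, canSlowHexFire (by norm_num)⟩, fun c hc => ?_⟩
  refine canSlowHexFire (lt_of_eq_of_lt ?_ hc)
  norm_num
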